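/- Let $\mathbf{k}$ be a field and let $\mathcal{C}$ be a tensor category over $\mathbf{k}$: an essentially small $\mathbf{k}$-linear abelian monoidal category with $\mathbf{k}$-bilinear tensor product and unit $\mathbb{1}$, in which every object has finite length and has a left and a right dual, and for which $\mathbf{k}\to\mathrm{End}_{\mathcal{C}}(\mathbb{1})$ is an isomorphism. For an object $X$, let $X^*$ denote the dual with evaluation $\mathrm{ev}_X\colon X^*\otimes X\to\mathbb{1}$ and coevaluation $\mathbb{1}\to X\otimes X^*$, and put $X^{(0)}=X$, $X^{(n+1)}=(X^{(n)})^*$. For an object $Y$, write $Y[0]$ for $Y$ viewed as a complex concentrated in degree $0$. Define chain complexes $\mathbb{E}_n(X)$ in $\mathcal{C}$ for $n\ge 0$, and chain maps $$\phi_n\colon \mathbb{E}_n(X)\to X^{(n-1)}\otimes\mathbb{E}_{n-1}(X),\qquad f_n\colon X^{(n)}\otimes\mathbb{E}_n(X)\to\mathbb{E}_{n-1}(X)\qquad(n\ge 1)$$ recursively as follows. Let $\mathbb{E}_0(X)=\mathbb{1}[0]$, let $\mathbb{E}_1(X)=X[0]$, and let $\phi_1$ be the canonical isomorphism $X[0]\simeq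 X\otimes\mathbb{1}[0]$. For $n\ge 1$, $f_n$ is the map adjoint to $\phi_n$, that is, $X^{(n)}\otimes\phi_n$ followed by the map induced by $\mathrm{ev}_{X^{(n-1)}}$. For $n\ge 2$, let $\mathbb{E}_n(X)=\mathrm{Cone}(f_{n-1})[-1]$, and let $\phi_n$ be the canonical map $\mathrm{Cone}(f_{n-1})[-1]\to X^{(n-1)}\otimes\mathbb{E}_{n-1}(X)$. Put $\mathbb{V}_i(X)=H_0(\mathbb{E}_i(X))\in\mathcal{C}$ for $i\ge 0$. Then for every $X\in\mathcal{C}$ there exists $n\in\mathbb{Z}_{>0}\cup\{\infty\}$ such that: 1. for all integers $0\le i<n$, we have $\mathbb{E}_i(X)\simeq\mathbb{V}_i(X)[0]\neq 0$ in the derived category $\mathcal{D}(\mathcal{C})$; 2. if $n<\infty$, then $\mathbb{E}_n(X)=0$ in $\mathcal{D}(\mathcal{C})$; 3. $\mathbb{V}_i(X)=0$ for all integers $i\ge n$. -/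

import Mathlib

open CategoryTheory MonoidalCategory Limits

universe w w' v u

namespace Continuant

/-- A tensor category over a field `k`: an essentially small `k`-linear abelian monoidal category
with `k`-bilinear tensor product, such that every object has a left and a right dual, every object
has finite length (the lengths of the finite strictly increasing chains of subobjects are bounded),
and `k → End 𝟙` is an isomorphism. The structure and its bilinearity are arguments, the remaining
properties are the fields. -/
class IsTensorCategory (k : Type*) [Field k] (C : Type u) [Category.{v} C] [Abelian C]
    [Linear k C] [MonoidalCategory C] [MonoidalPreadditive C] [MonoidalLinear k C]
    [RigidCategory C] : Prop where
  essentiallySmall : EssentiallySmall.{w} C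
  finite_length (X : C) : FiniteDimensionalOrder (Subobject X)
  bijective_smul_id : Function.Bijective (fun a : k => a • 𝟙 (𝟙_ C))

noncomputable section

variable {C : Type u} [Category.{v} C] [Abelian C] [MonoidalCategory C] [MonoidalPreadditive C]

/-- The complex `X ⊗ K`, for an object `X` and a complex `K`. -/
abbrev tensorComplex (X : C) (K : CochainComplex C ℤ) : CochainComplex C ℤ :=
  ((tensorLeft X).mapHomologicalComplex (ComplexShape.up ℤ)).obj K

/-- The chain map `X ⊗ φ : X ⊗ K ⟶ X ⊗ L`. -/
abbrev tensorComplexMap (X : C) {K L : CochainComplex C ℤ} (φ : K ⟶ L) :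
    tensorComplex X K ⟶ tensorComplex X L :=
  ((tensorLeft X).mapHomologicalComplex (ComplexShape.up ℤ)).map φ

variable [RigidCategory C]

/-- The chain map `X* ⊗ (X ⊗ K) ⟶ K` induced by the evaluation `X* ⊗ X ⟶ 𝟙`. Here `X*` is the dual
with evaluation `X* ⊗ X ⟶ 𝟙` and coevaluation `𝟙 ⟶ X ⊗ X*`, which is called the left dual in
[Etingof-Gelaki-Nikshych-Ostrik] and is written `Xᘁ` and called the right dual in Mathlib. -/
def evComplex (X : C) (K : CochainComplex C ℤ) :
    tensorComplex (Xᘁ) (tensorComplex X K) ⟶ K where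
  f i := (α_ (Xᘁ) X (K.X i)).inv ≫ ε_ X (Xᘁ) ▷ K.X i ≫ (λ_ (K.X i)).hom
  comm' i j _ := by
    change ((α_ (Xᘁ) X (K.X i)).inv ≫ ε_ X (Xᘁ) ▷ K.X i ≫ (λ_ (K.X i)).hom) ≫ K.d i j =
      Xᘁ ◁ X ◁ K.d i j ≫ (α_ (Xᘁ) X (K.X j)).inv ≫ ε_ X (Xᘁ) ▷ K.X j ≫ (λ_ (K.X j)).hom
    simp only [Category.assoc]
    rw [← leftUnitor_naturality, ← whisker_exchange_assoc, associator_inv_naturality_right_assoc]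

/-- Two consecutive continuant complexes: `dual = X^(n)` (the `n`-th iterated dual of `X`),
`lower = E_n(X)`, `upper = E_{n+1}(X)`, and the chain map
`φ = φ_{n+1} : E_{n+1}(X) ⟶ X^(n) ⊗ E_n(X)`. -/
structure Stage (C : Type u) [Category.{v} C] [Abelian C] [MonoidalCategory C]
    [MonoidalPreadditive C] where
  dual : C
  lower : CochainComplex C ℤ
  upper : CochainComplex C ℤ
  φ : upper ⟶ tensorComplex dual lower

/-- The chain map `f_{n+1} : X^(n+1) ⊗ E_{n+1}(X) ⟶ E_n(X)` which corresponds to `φ_{n+1}` by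
adjunction. -/
def Stage.f (S : Stage C) : tensorComplex (S.dualᘁ) S.upper ⟶ S.lower :=
  tensorComplexMap (S.dualᘁ) S.φ ≫ evComplex S.dual S.lower

/-- The first stage: `X^(0) = X`, `E_0(X) = 𝟙[0]`, `E_1(X) = X[0]`, and the canonical isomorphism
`φ_1 : X[0] ≅ X ⊗ 𝟙[0]`. -/
def Stage.zero (X : C) : Stage C where
  dual := X
  lower := (HomologicalComplex.single C (ComplexShape.up ℤ) 0).obj (𝟙_ C)
  upper := (HomologicalComplex.single C (ComplexShape.up ℤ) 0).obj X
  φ := (HomologicalComplex.single C (ComplexShape.up ℤ) 0).map (ρ_ X).inv ≫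
    (HomologicalComplex.singleMapHomologicalComplex (tensorLeft X) (ComplexShape.up ℤ) 0).inv.app
      (𝟙_ C)

/-- The next stage: `X^(n+1) = (X^(n))*`, `E_{n+2}(X) = Cone(f_{n+1})[-1]`, and `φ_{n+2}` is the
canonical map `Cone(f_{n+1})[-1] ⟶ X^(n+1) ⊗ E_{n+1}(X)`, which is the first map of the triangle
`Cone(f)[-1] ⟶ A ⟶ B ⟶ Cone(f)` of `f : A ⟶ B`. -/
def Stage.succ (S : Stage C) : Stage C where
  dual := S.dualᘁ
  lower := S.upper
  upper := (CochainComplex.mappingCone S.f)⟦(-1 : ℤ)⟧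
  φ := (CochainComplex.mappingCone.triangle S.f).invRotate.mor₁

/-- The stages, by iteration. -/
def stage (X : C) : ℕ → Stage C
  | 0 => Stage.zero X
  | n + 1 => (stage X n).succ

/-- The continuant complex `E_n(X)`. Complexes are indexed cohomologically: the homological degree
`i` of a chain complex is the degree `-i` here. -/
def E (X : C) (n : ℕ) : CochainComplex C ℤ := (stage X n).lower

/-- `V_n(X) = H_0(E_n(X))`. -/
def V (X : C) (n : ℕ) : C := (E X n).homology 0

end

end Continuant

namespace Continuant

/-! ### Transposition along duals, and pairs that come from the unit object. -/

section Rigid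

variable {C : Type u} [Category.{v} C] [MonoidalCategory C] [RigidCategory C]

/-! Tensoring with an object is exact, so the long exact sequence of the cone defining `E_{n+2}`
relates its homology to that of `X^(n+1) ⊗ E_{n+1}` and `E_n`. If `E_n` and `E_{n+1}` are
concentrated in degree `0`, the only obstruction for `E_{n+2}` is the cokernel of `H_0(f_{n+1})`.
Everything thus reduces to showing that this map is epi while `V_n` and `V_{n+1}` are nonzero.

The property carried through the induction is `ScalarPairs`: endomorphisms of `φ` with coefficients
in an object `B` all come from `𝟙 ⟶ B`. It holds at the start because `E_0` is the unit
(`ScalarPairs.of_iso`), and it passes to the kernel of an epi transpose (`ScalarPairs.step`). Since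
`𝟙` is simple (`IsTensorCategory.simple_unit`), it forces the transpose to be epi
(`ScalarPairs.epi_mate`): a map out of the cokernel would give a pair with zero second component,
hence a zero scalar.

Then `n` is the least index with `V_n = 0`, or `∞`. Vanishing persists beyond `n` because homology
in negative cohomological degrees is always zero, so that `V_{i+1}` embeds in `X^(i) ⊗ V_i`. -/

instance isLeftAdjoint_tensorLeft (X : C) : (tensorLeft X).IsLeftAdjoint :=
  (tensorLeftAdjunction (ᘁX) X).isLeftAdjoint

instance isRightAdjoint_tensorLeft (X : C) : (tensorLeft X).IsRightAdjoint :=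
  (tensorLeftAdjunction X (Xᘁ)).isRightAdjoint

instance isLeftAdjoint_tensorRight (X : C) : (tensorRight X).IsLeftAdjoint :=
  (tensorRightAdjunction X (Xᘁ)).isLeftAdjoint

instance isRightAdjoint_tensorRight (X : C) : (tensorRight X).IsRightAdjoint :=
  (tensorRightAdjunction (ᘁX) X).isRightAdjoint

instance mono_whiskerLeft (X : C) {Y Z : C} (f : Y ⟶ Z) [Mono f] : Mono (X ◁ f) :=
  inferInstanceAs (Mono ((tensorLeft X).map f))

instance epi_whiskerLeft (X : C) {Y Z : C} (f : Y ⟶ Z) [Epi f] : Epi (X ◁ f) :=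
  inferInstanceAs (Epi ((tensorLeft X).map f))

instance mono_whiskerRight (X : C) {Y Z : C} (f : Y ⟶ Z) [Mono f] : Mono (f ▷ X) :=
  inferInstanceAs (Mono ((tensorRight X).map f))

instance epi_whiskerRight (X : C) {Y Z : C} (f : Y ⟶ Z) [Epi f] : Epi (f ▷ X) :=
  inferInstanceAs (Epi ((tensorRight X).map f))

/-- The morphism `Dᘁ ⊗ U ⟶ L` adjoint to `φ : U ⟶ D ⊗ L`. -/
def mate {D L U : C} (φ : U ⟶ D ⊗ L) : Dᘁ ⊗ U ⟶ L :=
  (tensorLeftHomEquiv U D (Dᘁ) L).symm φ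

/-- A pair of morphisms `L ⟶ L ⊗ B` and `U ⟶ U ⊗ B` compatible with `φ : U ⟶ D ⊗ L` always comes
from a single morphism `𝟙 ⟶ B`. -/
def ScalarPairs {D L U : C} (φ : U ⟶ D ⊗ L) : Prop :=
  ∀ (B : C) (g : L ⟶ L ⊗ B) (h : U ⟶ U ⊗ B), φ ≫ D ◁ g = h ≫ φ ▷ B ≫ (α_ D L B).hom →
    ∃ t : 𝟙_ C ⟶ B, g = (ρ_ L).inv ≫ L ◁ t ∧ h = (ρ_ U).inv ≫ U ◁ t

omit [RigidCategory C] in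
lemma rightUnitor_inv_comp_whiskerLeft_comp {D L U B : C} (φ : U ⟶ D ⊗ L) (t : 𝟙_ C ⟶ B) :
    ((ρ_ U).inv ≫ U ◁ t) ≫ φ ▷ B ≫ (α_ D L B).hom = φ ≫ D ◁ ((ρ_ L).inv ≫ L ◁ t) := by
  rw [Category.assoc, whisker_exchange_assoc]
  simp

/-- If `φ` is mono, the second component of a compatible pair is determined by the first. -/
lemma eq_of_compatible {D L U B : C} (φ : U ⟶ D ⊗ L) [Mono φ] {h : U ⟶ U ⊗ B} {t : 𝟙_ C ⟶ B}
    (H : φ ≫ D ◁ ((ρ_ L).inv ≫ L ◁ t) = h ≫ φ ▷ B ≫ (α_ D L B).hom) :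
    h = (ρ_ U).inv ≫ U ◁ t := by
  rw [← rightUnitor_inv_comp_whiskerLeft_comp] at H
  exact ((cancel_mono _).1 H).symm

lemma mate_comp {D L L' U : C} (φ : U ⟶ D ⊗ L) (g : L ⟶ L') : mate (φ ≫ D ◁ g) = mate φ ≫ g := by
  apply (tensorLeftHomEquiv U D (Dᘁ) L').injective
  rw [tensorLeftHomEquiv_naturality]
  simp [mate]

lemma whiskerLeft_comp_mate {D L U U' : C} (g : U' ⟶ U) (φ : U ⟶ D ⊗ L) :
    mate (g ≫ φ) = Dᘁ ◁ g ≫ mate φ :=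
  tensorLeftHomEquiv_symm_naturality g φ

lemma mate_whiskerRight {D L U B : C} (φ : U ⟶ D ⊗ L) :
    mate (φ ▷ B ≫ (α_ D L B).hom) = (α_ (Dᘁ) U B).inv ≫ mate φ ▷ B := by
  have := tensorLeftHomEquiv_tensor (Y' := Dᘁ) φ (𝟙 B)
  simpa [mate] using this

lemma mate_injective {D L U : C} {φ ψ : U ⟶ D ⊗ L} (h : mate φ = mate ψ) : φ = ψ :=
  (tensorLeftHomEquiv U D (Dᘁ) L).symm.injective h

lemma ScalarPairs.of_iso {D L U : C} (φ : U ⟶ D ⊗ L) [Mono φ] (e : L ≅ 𝟙_ C) :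
    ScalarPairs φ := by
  intro B g h H
  obtain ⟨t, rfl⟩ : ∃ t : 𝟙_ C ⟶ B, g = (ρ_ L).inv ≫ L ◁ t := by
    refine ⟨e.inv ≫ g ≫ e.hom ▷ B ≫ (λ_ B).hom, ?_⟩
    rw [← cancel_mono (e.hom ▷ B), Category.assoc, whisker_exchange, ← cancel_epi e.inv,
      ← cancel_mono (λ_ B).hom]
    simp only [Category.assoc, leftUnitor_naturality, rightUnitor_inv_naturality_assoc]
    simp [unitors_equal]
  exact ⟨t, rfl, eq_of_compatible φ H⟩

end Rigid

/-! ### Inheritance of `ScalarPairs`, and surjectivity of the transpose. -/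

section Preadditive

variable {C : Type u} [Category.{v} C] [Abelian C] [MonoidalCategory C] [MonoidalPreadditive C]
  [RigidCategory C]

/-- Here `L` is the cokernel of `φ'`, so a pair compatible with `φ'` induces a map on `L`; this map
and the first component form a pair compatible with `φ`, to which the hypothesis applies. -/
lemma ScalarPairs.step {D L U U' : C} {φ : U ⟶ D ⊗ L} (hφ : ScalarPairs φ) [Epi (mate φ)]
    (φ' : U' ⟶ Dᘁ ⊗ U) [Mono φ'] (zero : φ' ≫ mate φ = 0)
    (exact : (ShortComplex.mk φ' (mate φ) zero).Exact) : ScalarPairs φ' := by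
  intro B g h H
  have := exact.epi_f'
  have hz : φ' ≫ (Dᘁ ◁ g ≫ (α_ (Dᘁ) U B).inv ≫ mate φ ▷ B) = 0 := by
    rw [reassoc_of% H, Iso.hom_inv_id_assoc, ← comp_whiskerRight, zero]
    simp
  let g₀ : L ⟶ L ⊗ B := exact.desc _ hz
  have hg₀ : mate φ ≫ g₀ = Dᘁ ◁ g ≫ (α_ (Dᘁ) U B).inv ≫ mate φ ▷ B := exact.g_desc _ hz
  obtain ⟨t, -, rfl⟩ := hφ B g₀ g (mate_injective (by
    rw [mate_comp, hg₀, whiskerLeft_comp_mate, mate_whiskerRight]))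
  exact ⟨t, rfl, eq_of_compatible φ' H⟩

lemma coevaluation_ne_zero {X : C} (hX : ¬ IsZero X) : η_ X (Xᘁ) ≠ 0 := by
  intro h
  apply hX
  have := ExactPairing.evaluation_coevaluation X (Xᘁ)
  rw [h] at this
  rw [IsZero.iff_id_eq_zero, ← cancel_epi (λ_ X).hom, ← cancel_mono (ρ_ X).inv]
  simpa using this.symm

/-- If `𝟙` is simple and `L` and `U` are nonzero, then the mate of `φ` is epi. -/
lemma ScalarPairs.epi_mate [Simple (𝟙_ C)] {D L U : C} {φ : U ⟶ D ⊗ L} (hφ : ScalarPairs φ)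
    (hL : ¬ IsZero L) (hU : ¬ IsZero U) : Epi (mate φ) := by
  refine Preadditive.epi_of_cancel_zero _ fun {Q} q hq => ?_
  have hq' : φ ≫ D ◁ q = 0 := mate_injective (by
    rw [mate_comp, hq]; simp [mate, tensorLeftHomEquiv])
  -- The coefficient object `Lᘁ ⊗ Q` lets an arbitrary `q : L ⟶ Q` be encoded, through the
  -- coevaluation of `L`, as a map `L ⟶ L ⊗ B`. It is compatible with `0` on `U` because `q` kills
  -- the image of `φ`.
  obtain ⟨t, ht, ht'⟩ := hφ (Lᘁ ⊗ Q) (q ≫ (λ_ Q).inv ≫ η_ L (Lᘁ) ▷ Q ≫ (α_ _ _ _).hom) 0 (by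
    rw [MonoidalCategory.whiskerLeft_comp, reassoc_of% hq']; simp)
  -- A nonzero `t` is mono by simplicity of `𝟙`; then `U ◁ t` is both mono and zero, which
  -- contradicts `U ≠ 0`.
  have h0 : t = 0 := by
    by_contra h
    have := mono_of_nonzero_from_simple h
    apply hU
    rw [IsZero.iff_id_eq_zero, ← cancel_mono ((ρ_ U).inv ≫ U ◁ t), ← ht']
    simp
  have := mono_of_nonzero_from_simple (coevaluation_ne_zero hL)
  rw [← cancel_mono ((λ_ Q).inv ≫ η_ L (Lᘁ) ▷ Q ≫ (α_ _ _ _).hom), ht, h0]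
  simp

end Preadditive

/-! ### Simplicity of the unit object. -/

section TensorCategory

variable {C : Type u} [Category.{v} C] [Abelian C] [MonoidalCategory C] [MonoidalPreadditive C]
  [RigidCategory C]

/-- The map is the transpose of `i`. If `z` kills it, the mono `i ▷ Z` kills the morphism `𝟙 ⟶ X ⊗
Z` corresponding to `z`, so `z = 0`. -/
lemma epi_coevaluation_comp_of_mono {X : C} (i : X ⟶ 𝟙_ C) [Mono i] :
    Epi (η_ X (Xᘁ) ≫ i ▷ (Xᘁ) ≫ (λ_ (Xᘁ)).hom) := by
  refine Preadditive.epi_of_cancel_zero _ fun {Z} z hz => ?_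
  have h₁ : (η_ X (Xᘁ) ≫ X ◁ z) ≫ i ▷ Z ≫ (λ_ Z).hom = 0 := by
    rw [← hz]
    simp [whisker_exchange_assoc]
  have h₂ : η_ X (Xᘁ) ≫ X ◁ z = 0 := by
    rwa [← cancel_mono (i ▷ Z ≫ (λ_ Z).hom), zero_comp]
  have h₃ := tensorLeftHomEquiv_symm_coevaluation_comp_whiskerLeft (Y := X) z
  rw [h₂] at h₃
  rw [← cancel_epi (ρ_ (Xᘁ)).hom, ← h₃]
  simp [tensorLeftHomEquiv]

lemma exists_unit_comp_ne_zero {X : C} [Simple X] (i : X ⟶ 𝟙_ C) [Mono i] :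
    ∃ j : 𝟙_ C ⟶ X, j ≫ i ≠ 0 := by
  have hX : ¬ IsZero X := Simple.not_isZero X
  have hη := coevaluation_ne_zero hX
  have := epi_coevaluation_comp_of_mono i
  -- Tensoring the epi `𝟙 ⟶ Xᘁ` with the simple object `X` gives an epi with nonzero target, hence
  -- an isomorphism; its inverse turns the coevaluation into a map `𝟙 ⟶ X`.
  let s : X ⟶ X ⊗ Xᘁ := (ρ_ X).inv ≫ X ◁ (η_ X (Xᘁ) ≫ i ▷ (Xᘁ) ≫ (λ_ (Xᘁ)).hom)
  have : Epi s := inferInstance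
  have : Mono s := mono_of_nonzero_from_simple fun h => hη <| by
    rw [← cancel_mono (𝟙 _), zero_comp]
    have : 𝟙 (X ⊗ Xᘁ) = 0 := by rw [← cancel_epi s, h]; simp
    rw [this, comp_zero]
  have : IsIso s := isIso_of_mono_of_epi s
  refine ⟨η_ X (Xᘁ) ≫ inv s, fun h => hη ?_⟩
  rwa [← cancel_mono (inv s ≫ i), zero_comp, ← Category.assoc]

variable (k : Type*) [Field k] [Linear k C] [MonoidalLinear k C]

-- Finite length provides a simple subobject `i` of `𝟙`. A nonzero composite `𝟙 ⟶ X ⟶ 𝟙` is an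
-- invertible scalar because `End 𝟙 = k`, so `i` is split epi as well as mono.
include k in
lemma IsTensorCategory.simple_unit [IsTensorCategory.{w} k C] : Simple (𝟙_ C) := by
  have hb := IsTensorCategory.bijective_smul_id.{w} (k := k) (C := C)
  have : FiniteDimensionalOrder (Subobject (𝟙_ C)) := IsTensorCategory.finite_length.{w} k _
  have : IsArtinianObject (𝟙_ C) := ⟨⟨SetRel.IsWellFounded.of_finiteDimensional
    {(a, b) : Subobject (𝟙_ C) × Subobject (𝟙_ C) | a < b}⟩⟩
  have h1 : ¬ IsZero (𝟙_ C) := fun h => one_ne_zero (hb.1 (h.eq_of_src _ _) : (1 : k) = 0)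
  let i := simpleSubobjectArrow h1
  obtain ⟨j, hj⟩ := exists_unit_comp_ne_zero i
  obtain ⟨a, ha⟩ := hb.2 (j ≫ i)
  have ha0 : a ≠ 0 := by
    rintro rfl
    exact hj (by rw [← ha]; simp)
  have : (a⁻¹ • j) ≫ i = 𝟙 _ := by
    rw [Linear.smul_comp, ← ha, smul_smul, inv_mul_cancel₀ ha0, one_smul]
  have : IsSplitEpi i := ⟨⟨⟨_, this⟩⟩⟩
  have : IsIso i := isIso_of_mono_of_epi i
  exact Simple.of_iso (asIso i).symm

end TensorCategory

/-! ### Homology of tensored complexes and of the maps `φ` and `f`. -/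

noncomputable section

variable {C : Type u} [Category.{v} C] [Abelian C] [MonoidalCategory C] [MonoidalPreadditive C]
  [RigidCategory C]

instance preservesHomology_tensorLeft (X : C) : (tensorLeft X).PreservesHomology := by
  have := (Adjunction.ofIsLeftAdjoint (tensorLeft X)).leftAdjoint_preservesColimits
  have := (Adjunction.ofIsRightAdjoint (tensorLeft X)).rightAdjoint_preservesLimits
  infer_instance

/-- Tensoring with an object commutes with homology. -/
def tensorHomologyIso (X : C) (K : CochainComplex C ℤ) (n : ℤ) :
    (tensorComplex X K).homology n ≅ X ⊗ K.homology n :=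
  (K.sc n).mapHomologyIso (tensorLeft X)

lemma tensorHomologyIso_hom_naturality (X : C) {K L : CochainComplex C ℤ} (φ : K ⟶ L) (n : ℤ) :
    HomologicalComplex.homologyMap (tensorComplexMap X φ) n ≫ (tensorHomologyIso X L n).hom =
      (tensorHomologyIso X K n).hom ≫ X ◁ HomologicalComplex.homologyMap φ n :=
  ShortComplex.mapHomologyIso_hom_naturality
    ((HomologicalComplex.shortComplexFunctor C (ComplexShape.up ℤ) n).map φ) (tensorLeft X)

omit [Abelian C] [MonoidalPreadditive C] in
lemma mate_id_naturality (X : C) {Y Z : C} (f : Y ⟶ Z) :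
    mate (𝟙 (X ⊗ Y)) ≫ f = Xᘁ ◁ X ◁ f ≫ mate (𝟙 (X ⊗ Z)) := by
  rw [← mate_comp, ← whiskerLeft_comp_mate, Category.id_comp, Category.comp_id]

lemma evComplex_f (X : C) (K : CochainComplex C ℤ) (i : ℤ) :
    (evComplex X K).f i = mate (𝟙 (X ⊗ K.X i)) := by
  change _ = Xᘁ ◁ 𝟙 _ ≫ (α_ (Xᘁ) X (K.X i)).inv ≫ ε_ X (Xᘁ) ▷ K.X i ≫ (λ_ (K.X i)).hom
  rw [MonoidalCategory.whiskerLeft_id, Category.id_comp]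
  rfl

/-- The effect of `evComplex X K` on left homology data. -/
def evHomologyMapData (X : C) (K : CochainComplex C ℤ) (n : ℤ) (h : (K.sc n).LeftHomologyData) :
    ShortComplex.LeftHomologyMapData
      ((HomologicalComplex.shortComplexFunctor C (ComplexShape.up ℤ) n).map (evComplex X K))
      ((h.map (tensorLeft X)).map (tensorLeft (Xᘁ))) h where
  φK := mate (𝟙 (X ⊗ h.K))
  φH := mate (𝟙 (X ⊗ h.H))
  commi := by
    change mate (𝟙 (X ⊗ h.K)) ≫ h.i = Xᘁ ◁ X ◁ h.i ≫ (evComplex X K).f n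
    rw [evComplex_f]
    exact mate_id_naturality X h.i
  commf' := by
    have e : ((h.map (tensorLeft X)).map (tensorLeft (Xᘁ))).f' = Xᘁ ◁ X ◁ h.f' := by
      rw [ShortComplex.LeftHomologyData.map_f', ShortComplex.LeftHomologyData.map_f']
      rfl
    refine (congrArg (· ≫ mate (𝟙 (X ⊗ h.K))) e).trans ?_
    change _ = (evComplex X K).f _ ≫ h.f'
    rw [evComplex_f]
    exact (mate_id_naturality X h.f').symm
  commπ := (mate_id_naturality X h.π).symm

omit [Abelian C] [MonoidalPreadditive C] in
lemma comp_mate_id_comp_hom {X P J H H' : C} (p : P ⟶ Xᘁ ⊗ X ⊗ H) (j : J ≅ X ⊗ H) (i : H ≅ H') :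
    p ≫ mate (𝟙 (X ⊗ H)) ≫ i.hom =
      (p ≫ Xᘁ ◁ j.inv) ≫ Xᘁ ◁ (j.hom ≫ X ◁ i.hom) ≫ mate (𝟙 (X ⊗ H')) := by
  simp [mate_id_naturality X i.hom]

/-- Evaluation is natural in the object it acts on, so it restricts to cycles and descends to
homology as evaluation again. -/
lemma homologyMap_evComplex (X : C) (K : CochainComplex C ℤ) (n : ℤ) :
    HomologicalComplex.homologyMap (evComplex X K) n =
      (tensorHomologyIso (Xᘁ) (tensorComplex X K) n).hom ≫
        Xᘁ ◁ (tensorHomologyIso X K n).hom ≫ mate (𝟙 (X ⊗ K.homology n)) := by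
  let h := (K.sc n).leftHomologyData
  have e₁ : tensorHomologyIso (Xᘁ) (tensorComplex X K) n =
      ((h.map (tensorLeft X)).map (tensorLeft (Xᘁ))).homologyIso ≪≫
        (tensorLeft (Xᘁ)).mapIso (h.map (tensorLeft X)).homologyIso.symm :=
    (h.map (tensorLeft X)).mapHomologyIso_eq (tensorLeft (Xᘁ))
  have e₂ : tensorHomologyIso X K n = (h.map (tensorLeft X)).homologyIso ≪≫
        (tensorLeft X).mapIso h.homologyIso.symm :=
    h.mapHomologyIso_eq (tensorLeft X)
  refine ((evHomologyMapData X K n h).homologyMap_eq).trans ?_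
  rw [e₁, e₂]
  exact comp_mate_id_comp_hom _ (h.map (tensorLeft X)).homologyIso h.homologyIso.symm

/-- The map induced on homology by the map `φ` of a stage. -/
def Stage.homologyφ (S : Stage C) (n : ℤ) : S.upper.homology n ⟶ S.dual ⊗ S.lower.homology n :=
  HomologicalComplex.homologyMap S.φ n ≫ (tensorHomologyIso S.dual S.lower n).hom

/-- Transposition commutes with homology, which allows the results on `mate` to be applied to the
chain map `f`. -/
lemma Stage.homologyMap_f (S : Stage C) (n : ℤ) :
    HomologicalComplex.homologyMap S.f n =
      (tensorHomologyIso (S.dualᘁ) S.upper n).hom ≫ mate (S.homologyφ n) := by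
  rw [Stage.f, HomologicalComplex.homologyMap_comp, homologyMap_evComplex,
    reassoc_of% tensorHomologyIso_hom_naturality (S.dualᘁ) S.φ n, ← whiskerLeft_comp_mate,
    ← whiskerLeft_comp_mate, homologyφ, Category.comp_id]

end

/-! ### The long exact homology sequence of a shifted cone. -/

section LongExactSequence

variable {C : Type u} [Category.{v} C] [Abelian C] {K L : CochainComplex C ℤ} (f : K ⟶ L)

lemma invRotate_triangle_distinguished [HasDerivedCategory.{w'} C] :
    DerivedCategory.Q.mapTriangle.obj (CochainComplex.mappingCone.triangle f).invRotate ∈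
      Pretriangulated.distinguishedTriangles :=
  Pretriangulated.isomorphic_distinguished _
    (Pretriangulated.inv_rot_of_distTriang _
      (DerivedCategory.mappingCone_triangle_distinguished f)) _
    (DerivedCategory.Q.mapTriangleInvRotateIso.app _).symm

lemma homologyMap_comp_eq_zero [HasDerivedCategory.{w'} C] {K₁ K₂ K₃ : CochainComplex C ℤ}
    (p : K₁ ⟶ K₂) (q : K₂ ⟶ K₃) (n : ℤ)
    (h : DerivedCategory.Q.map p ≫ DerivedCategory.Q.map q = 0) :
    HomologicalComplex.homologyMap p n ≫ HomologicalComplex.homologyMap q n = 0 := by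
  have e := DerivedCategory.homologyFunctorFactors_hom_naturality (p ≫ q) n
  rw [Functor.map_comp, h, Functor.map_zero, zero_comp] at e
  rw [← HomologicalComplex.homologyMap_comp]
  exact (cancel_epi ((DerivedCategory.homologyFunctorFactors C n).hom.app K₁)).1
    (e.symm.trans comp_zero.symm)

lemma homologyMap_invRotate_mor₁_comp (n : ℤ) :
    HomologicalComplex.homologyMap (CochainComplex.mappingCone.triangle f).invRotate.mor₁ n ≫
      HomologicalComplex.homologyMap f n = 0 := by
  let := HasDerivedCategory.standard C
  exact homologyMap_comp_eq_zero _ f n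
    (Pretriangulated.comp_distTriang_mor_zero₁₂ _ (invRotate_triangle_distinguished f))

lemma exact_homologyMap_invRotate_mor₁ (n : ℤ) :
    (ShortComplex.mk _ _ (homologyMap_invRotate_mor₁_comp f n)).Exact := by
  let := HasDerivedCategory.standard C
  have h := DerivedCategory.HomologySequence.exact₂ _ (invRotate_triangle_distinguished f) n
  refine (ShortComplex.exact_iff_of_iso ?_).1 h
  exact ShortComplex.isoMk ((DerivedCategory.homologyFunctorFactors C n).app _)
    ((DerivedCategory.homologyFunctorFactors C n).app _)
    ((DerivedCategory.homologyFunctorFactors C n).app _)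
    (DerivedCategory.homologyFunctorFactors_hom_naturality _ n).symm
    (DerivedCategory.homologyFunctorFactors_hom_naturality f n).symm

/-- Both conditions say that the connecting map from degree `n₀` to degree `n₁` vanishes. -/
lemma mono_homologyMap_invRotate_mor₁_iff (n₀ n₁ : ℤ) (h : n₀ + 1 = n₁) :
    Mono (HomologicalComplex.homologyMap
      (CochainComplex.mappingCone.triangle f).invRotate.mor₁ n₁) ↔
      Epi (HomologicalComplex.homologyMap f n₀) := by
  let := HasDerivedCategory.standard C
  have hT := invRotate_triangle_distinguished f
  have h₁ := (DerivedCategory.HomologySequence.mono_homologyMap_mor₁_iff _ hT n₀ n₁ h).trans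
    (DerivedCategory.HomologySequence.epi_homologyMap_mor₂_iff _ hT n₀ n₁ h).symm
  have e {A B : CochainComplex C ℤ} (g : A ⟶ B) (n : ℤ) :
      Arrow.mk ((DerivedCategory.homologyFunctor C n).map (DerivedCategory.Q.map g)) ≅
        Arrow.mk (HomologicalComplex.homologyMap g n) :=
    Arrow.isoMk ((DerivedCategory.homologyFunctorFactors C n).app _)
      ((DerivedCategory.homologyFunctorFactors C n).app _)
      (DerivedCategory.homologyFunctorFactors_hom_naturality g n).symm
  exact ((MorphismProperty.monomorphisms C).arrow_mk_iso_iff (e _ n₁)).symm.trans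
    (h₁.trans ((MorphismProperty.epimorphisms C).arrow_mk_iso_iff (e _ n₀)))

end LongExactSequence

/-! ### Objects of the derived category concentrated in degree `0`. -/

section Concentrated

variable {C : Type u} [Category.{v} C] [Abelian C] [HasDerivedCategory.{w'} C]

lemma nonempty_Q_obj_iso_single {K : CochainComplex C ℤ}
    (hK : ∀ j : ℤ, j ≠ 0 → IsZero (K.homology j)) :
    Nonempty (DerivedCategory.Q.obj K ≅
      (DerivedCategory.singleFunctor C 0).obj (K.homology 0)) := by
  have : (DerivedCategory.Q.obj K).IsGE 0 := by
    rw [DerivedCategory.isGE_Q_obj_iff, CochainComplex.isGE_iff]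
    exact fun i hi => (HomologicalComplex.exactAt_iff_isZero_homology _ _).2 (hK i hi.ne)
  have : (DerivedCategory.Q.obj K).IsLE 0 := by
    rw [DerivedCategory.isLE_Q_obj_iff, CochainComplex.isLE_iff]
    exact fun i hi => (HomologicalComplex.exactAt_iff_isZero_homology _ _).2 (hK i hi.ne')
  obtain ⟨Y, ⟨e⟩⟩ :=
    (DerivedCategory.Q.obj K).exists_iso_singleFunctor_obj_of_isGE_of_isLE 0
  let e' : Y ≅ K.homology 0 :=
    ((DerivedCategory.singleFunctorCompHomologyFunctorIso C 0).app Y).symm ≪≫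
      (DerivedCategory.homologyFunctor C 0).mapIso e.symm ≪≫
      (DerivedCategory.homologyFunctorFactors C 0).app K
  exact ⟨e ≪≫ (DerivedCategory.singleFunctor C 0).mapIso e'⟩

lemma isZero_singleFunctor_obj_iff (Y : C) :
    IsZero ((DerivedCategory.singleFunctor C 0).obj Y) ↔ IsZero Y :=
  ⟨fun h => ((DerivedCategory.homologyFunctor C 0).map_isZero h).of_iso
    ((DerivedCategory.singleFunctorCompHomologyFunctorIso C 0).app Y).symm,
    fun h => (DerivedCategory.singleFunctor C 0).map_isZero h⟩

end Concentrated

/-! ### The induction along the continuant complexes. -/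

section Stages

variable {C : Type u} [Category.{v} C] [Abelian C] [MonoidalCategory C] [MonoidalPreadditive C]
  [RigidCategory C]

omit [RigidCategory C] in
lemma isZero_tensor (X : C) {Y : C} (h : IsZero Y) : IsZero (X ⊗ Y) :=
  (tensorLeft X).map_isZero h

/-- The map `φ` of the next stage, on homology. -/
noncomputable def Stage.succHomologyφ (S : Stage C) (n : ℤ) :
    S.succ.upper.homology n ⟶ S.dualᘁ ⊗ S.upper.homology n :=
  S.succ.homologyφ n

lemma Stage.succHomologyφ_comp_mate (S : Stage C) (n : ℤ) :
    S.succHomologyφ n ≫ mate (S.homologyφ n) = 0 := by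
  have := homologyMap_invRotate_mor₁_comp S.f n
  rw [S.homologyMap_f] at this
  exact (Category.assoc _ _ _).trans this

lemma Stage.exact_succHomologyφ (S : Stage C) (n : ℤ) :
    (ShortComplex.mk _ _ (S.succHomologyφ_comp_mate n)).Exact := by
  refine (ShortComplex.exact_iff_of_iso ?_).1 (exact_homologyMap_invRotate_mor₁ S.f n)
  refine ShortComplex.isoMk (Iso.refl _) (tensorHomologyIso (S.dualᘁ) S.upper n) (Iso.refl _)
    (Category.id_comp _) ?_
  exact (S.homologyMap_f n).symm.trans (Category.comp_id _).symm

lemma Stage.mono_succHomologyφ_iff (S : Stage C) (n₀ n₁ : ℤ) (h : n₀ + 1 = n₁) :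
    Mono (S.succHomologyφ n₁) ↔ Epi (mate (S.homologyφ n₀)) := by
  refine Iff.trans ?_ ((mono_homologyMap_invRotate_mor₁_iff S.f n₀ n₁ h).trans ?_)
  · exact (MorphismProperty.monomorphisms C).cancel_right_of_respectsIso _
      (tensorHomologyIso (S.dualᘁ) S.upper n₁).hom
  · rw [S.homologyMap_f]
    exact (MorphismProperty.epimorphisms C).cancel_left_of_respectsIso _ _

lemma Stage.isZero_homology_succ_upper (S : Stage C) (n₀ n₁ : ℤ) (h : n₀ + 1 = n₁)
    (h₁ : IsZero (S.upper.homology n₁)) (h₀ : Epi (mate (S.homologyφ n₀))) :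
    IsZero (S.succ.upper.homology n₁) := by
  have := (S.mono_succHomologyφ_iff n₀ n₁ h).2 h₀
  exact (isZero_tensor _ h₁).of_mono (S.succHomologyφ n₁)

omit [Abelian C] [MonoidalCategory C] [MonoidalPreadditive C] [RigidCategory C] in
lemma epi_of_isZero {Y Z : C} (f : Y ⟶ Z) (h : IsZero Z) : Epi f :=
  ⟨fun _ _ _ => h.eq_of_src _ _⟩

/-- The two complexes of a stage are exact except in degree `0`, where their homology satisfies
the hypotheses of the induction. -/
structure Stage.Concentrated (S : Stage C) : Prop where
  isZero_lower (j : ℤ) (hj : j ≠ 0) : IsZero (S.lower.homology j)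
  isZero_upper (j : ℤ) (hj : j ≠ 0) : IsZero (S.upper.homology j)
  mono : Mono (S.homologyφ 0)
  scalarPairs : ScalarPairs (S.homologyφ 0)

lemma Stage.concentrated_zero (X : C) : (Stage.zero X).Concentrated := by
  have hmono : Mono ((Stage.zero X).homologyφ 0) := by
    have : IsIso (Stage.zero X).φ := by
      dsimp only [Stage.zero]
      infer_instance
    dsimp only [Stage.homologyφ]
    infer_instance
  exact {
    isZero_lower := fun j hj => HomologicalComplex.isZero_single_obj_homology _ _ _ _ hj
    isZero_upper := fun j hj => HomologicalComplex.isZero_single_obj_homology _ _ _ _ hj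
    mono := hmono
    scalarPairs := ScalarPairs.of_iso _
      (HomologicalComplex.singleObjHomologySelfIso (ComplexShape.up ℤ) 0 (𝟙_ C)) }

lemma Stage.Concentrated.succ [Simple (𝟙_ C)] {S : Stage C} (hS : S.Concentrated)
    (h₀ : ¬ IsZero (S.lower.homology 0)) (h₁ : ¬ IsZero (S.upper.homology 0)) :
    S.succ.Concentrated := by
  have hepi : Epi (mate (S.homologyφ 0)) := hS.scalarPairs.epi_mate h₀ h₁
  have hepi' (j : ℤ) : Epi (mate (S.homologyφ j)) := by
    obtain rfl | hj := eq_or_ne j 0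
    · exact hepi
    · exact epi_of_isZero _ (hS.isZero_lower j hj)
  have hmono : Mono (S.succHomologyφ 0) :=
    -- Injectivity in degree `0` only needs surjectivity in degree `-1`, where the target is zero.
    (S.mono_succHomologyφ_iff (-1) 0 (by simp)).2 (hepi' _)
  exact {
    isZero_lower := hS.isZero_upper
    isZero_upper := fun j hj =>
      -- Only `j = 1` uses surjectivity on `H_0`; for every other `j` the target in degree `j - 1`
      -- is zero.
      S.isZero_homology_succ_upper (j - 1) j (by simp) (hS.isZero_upper j hj) (hepi' _)
    mono := hmono
    scalarPairs := hS.scalarPairs.step (S.succHomologyφ 0) (S.succHomologyφ_comp_mate 0)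
      (S.exact_succHomologyφ 0) }

lemma stage_concentrated [Simple (𝟙_ C)] (X : C) (m : ℕ)
    (h : ∀ i : ℕ, i ≤ m → ¬ IsZero (V X i)) : (stage X m).Concentrated := by
  induction m with
  | zero => exact Stage.concentrated_zero X
  | succ m ih =>
    exact (ih fun i hi => h i (hi.trans m.le_succ)).succ (h m m.le_succ) (h (m + 1) le_rfl)

/-- No nonvanishing of the `V_i` is needed, so this remains available after the first zero, where
`Stage.Concentrated` no longer propagates. -/
lemma isZero_homology_of_neg (X : C) (m : ℕ) (j : ℤ) (hj : j < 0) :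
    IsZero ((E X m).homology j) := by
  suffices ∀ m : ℕ, (∀ j : ℤ, j < 0 → IsZero ((stage X m).lower.homology j)) ∧
      ∀ j : ℤ, j < 0 → IsZero ((stage X m).upper.homology j) from (this m).1 j hj
  intro m
  induction m with
  | zero =>
    exact ⟨fun j hj => (Stage.concentrated_zero X).isZero_lower j hj.ne,
      fun j hj => (Stage.concentrated_zero X).isZero_upper j hj.ne⟩
  | succ m ih =>
    exact ⟨ih.2, fun j hj => (stage X m).isZero_homology_succ_upper (j - 1) j (by simp)
      (ih.2 j hj) (epi_of_isZero _ (ih.1 _ (by lia)))⟩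

/-- The kernel of `V_{m+1} ⟶ X^(m) ⊗ V_m` is a quotient of the degree `-1` homology of `E_{m-1}`,
which is zero; this is where `m ≠ 0` enters. -/
lemma isZero_V_succ (X : C) {m : ℕ} (hm : m ≠ 0) (h : IsZero (V X m)) :
    IsZero (V X (m + 1)) := by
  obtain ⟨m, rfl⟩ := Nat.exists_eq_succ_of_ne_zero hm
  exact (stage X m).isZero_homology_succ_upper (-1) 0 (by simp) h
    (epi_of_isZero _ (isZero_homology_of_neg X m (-1) (by simp)))

lemma isZero_V_of_le (X : C) {m : ℕ} (hm : m ≠ 0) (h : IsZero (V X m)) {i : ℕ} (hi : m ≤ i) :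
    IsZero (V X i) := by
  induction i, hi using Nat.le_induction with
  | base => exact h
  | succ i hi ih => exact isZero_V_succ X (by lia) ih

/-- If `V_i(X) ≠ 0` for all `i < m`, then `E_m(X)` is concentrated in degree `0`. -/
lemma isZero_homology_E [Simple (𝟙_ C)] (X : C) {m : ℕ} (h : ∀ i < m, ¬ IsZero (V X i)) (j : ℤ)
    (hj : j ≠ 0) : IsZero ((E X m).homology j) := by
  obtain _ | m := m
  · exact (Stage.concentrated_zero X).isZero_lower j hj
  · exact (stage_concentrated X m fun i hi => h i (by lia)).isZero_upper j hj

lemma not_isZero_V_zero [Simple (𝟙_ C)] (X : C) : ¬ IsZero (V X 0) := fun h =>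
  Simple.not_isZero (𝟙_ C) (h.of_iso
    (HomologicalComplex.singleObjHomologySelfIso (ComplexShape.up ℤ) 0 (𝟙_ C)).symm)

end Stages

end Continuant

theorem theorem3p2 {k : Type*} [Field k] {C : Type u} [Category.{v} C] [Abelian C] [Linear k C]
    [MonoidalCategory C] [MonoidalPreadditive C] [MonoidalLinear k C] [RigidCategory C]
    [Continuant.IsTensorCategory.{w} k C] [HasDerivedCategory.{w'} C] (X : C) :
    ∃ n : ℕ∞, 0 < n ∧
      (∀ i : ℕ, (i : ℕ∞) < n →
        Nonempty (DerivedCategory.Q.obj (Continuant.E X i) ≅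
          (DerivedCategory.singleFunctor C 0).obj (Continuant.V X i)) ∧
        ¬ IsZero ((DerivedCategory.singleFunctor C 0).obj (Continuant.V X i))) ∧
      (∀ m : ℕ, n = (m : ℕ∞) → IsZero (DerivedCategory.Q.obj (Continuant.E X m))) ∧
      (∀ i : ℕ, n ≤ (i : ℕ∞) → IsZero (Continuant.V X i)) := by
  have : Simple (𝟙_ C) := Continuant.IsTensorCategory.simple_unit.{w} k
  have hlt (m : ℕ) (h : ∀ i < m, ¬ IsZero (Continuant.V X i)) :
      Nonempty (DerivedCategory.Q.obj (Continuant.E X m) ≅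
        (DerivedCategory.singleFunctor C 0).obj (Continuant.V X m)) :=
    Continuant.nonempty_Q_obj_iso_single (Continuant.isZero_homology_E X h)
  by_cases hV : ∃ m, IsZero (Continuant.V X m)
  · classical
    have hmin : ∀ i < Nat.find hV, ¬ IsZero (Continuant.V X i) := fun i hi => Nat.find_min hV hi
    have hpos : Nat.find hV ≠ 0 := fun h =>
      Continuant.not_isZero_V_zero X (h ▸ Nat.find_spec hV)
    refine ⟨Nat.find hV, by exact_mod_cast Nat.pos_of_ne_zero hpos, fun i hi => ?_,
      fun m hm => ?_, fun i hi => ?_⟩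
    · have hi' : i < Nat.find hV := by exact_mod_cast hi
      exact ⟨hlt i fun j hj => hmin j (hj.trans hi'),
        fun h => hmin i hi' ((Continuant.isZero_singleFunctor_obj_iff _).1 h)⟩
    · obtain rfl : Nat.find hV = m := by exact_mod_cast hm
      -- Nonvanishing strictly below the least zero already makes `E_n` concentrated in degree `0`,
      -- so `V_n = 0` forces `E_n = 0`.
      obtain ⟨e⟩ := hlt _ hmin
      exact ((Continuant.isZero_singleFunctor_obj_iff _).2 (Nat.find_spec hV)).of_iso e
    · exact Continuant.isZero_V_of_le X hpos (Nat.find_spec hV) (by exact_mod_cast hi)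
  · push Not at hV
    exact ⟨⊤, by simp, fun i _ => ⟨hlt i fun j _ => hV j,
      fun h => hV i ((Continuant.isZero_singleFunctor_obj_iff _).1 h)⟩,
      fun m hm => absurd hm.symm (ENat.natCast_ne_top m), fun i hi => absurd hi (by simp)⟩
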